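/- Conventions. Topological groups are Hausdorff. An approximate subgroup of a group $G$ is a subset $\Lambda\subset G$ with $e\in\Lambda=\Lambda^{-1}$ and $\Lambda^2\subset F\Lambda$ for some finite $F\subset G$, where $\Lambda^2=\{\lambda_1\lambda_2:\lambda_1,\lambda_2\in\Lambda\}$. A subset $\Lambda$ of a locally compact group $G$ is uniformly discrete if $\Lambda\Lambda^{-1}\cap V=\{e\}$ for some neighbourhood $V$ of $e$ (such a $\Lambda$ is closed). A subset of a topological space is locally finite if it meets every compact subset in a finite set. A uniform approximate lattice in $G$ is a uniformly discrete approximate subgroup $\Lambda$ with $\Lambda K=G$ for some compact $K\subset G$. For $G$ second countable, let $\mathcal C(G)$ be the set of closed subsets of $G$ with the Chabauty--Fell topology, i.e. the one generated by the sets $\{F: F\cap V\neq\emptyset\}$ ($V\subset G$ open) and $\{F: F\cap K=\emptyset\}$ ($K\subset G$ compact), on which $G$ acts by $(g,F)\mapsto gF$. The invariant hull of $F\in\mathcal C(G)$ is $\Omega_F=\overline{G\cdot F}\subset\mathcal C(G)$. A Borel probability measure $\nu$ on $\Omega_F$ is proper if $\nu(\{\emptyset\})=0$. A strong approximate lattice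 in $G$ is a uniformly discrete approximate subgroup $\Lambda$ of $G$ such that there is a proper $G$-invariant Borel probability measure on $\Omega_\Lambda$. A locally compact group is amenable if there is a left-invariant mean on its bounded continuous real functions. **Proposition.** Let $\Lambda$ be a uniformly discrete approximate subgroup of a locally compact group $G$, and let $H$ be a closed subgroup of $G$ such that $p(\Lambda)$ is locally finite in $G/H$, where $p:G\to G/H$ is the natural map. Then: 1. If $\Lambda$ is a uniform approximate lattice in $G$, then $\Lambda^2\cap H$ is a uniform approximate lattice in $H$. 2. If $G$ is second countable, $\Lambda$ is a strong approximate lattice in $G$ and $H$ is normal in $G$, then there is $P\in\Omega_\Lambda$ such that there is a proper $H$-invariant Borel probability measure on the invariant hull $\Omega_{P\cap H}\subset\mathcal C(H)$ of $P\cap H$, where $P\cap H$ is regarded as a closed subset of $H$. 3. If $G$ is second countable, $\Lambda$ is a strong approximate lattice in $G$ and $H$ is normal in $G$ and amenable, then $\Lambda^2\cap H$ is a strong approximate lattice in $H$. -/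

import Mathlib

open Set Topology MeasureTheory
open scoped Pointwise BoundedContinuousFunction

/-- The set `𝒞(X)` of closed subsets of `X`, as a type of its own so that it carries the
Chabauty-Fell topology (and no other topology that is put on closed subsets). -/
def ClosedSubset (X : Type*) [TopologicalSpace X] : Type _ := TopologicalSpace.Closeds X

namespace ClosedSubset

instance instSetLike (X : Type*) [TopologicalSpace X] : SetLike (ClosedSubset X) X :=
  inferInstanceAs (SetLike (TopologicalSpace.Closeds X) X)

theorem isClosed {X : Type*} [TopologicalSpace X] (F : ClosedSubset X) :
    IsClosed (F : Set X) :=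
  TopologicalSpace.Closeds.isClosed (α := X) F

/-- The Chabauty-Fell topology: a subbase of open sets is given by the sets
`{F | F ∩ V ≠ ∅}` for `V` open and `{F | F ∩ K = ∅}` for `K` compact. -/
instance instTopologicalSpace (X : Type*) [TopologicalSpace X] :
    TopologicalSpace (ClosedSubset X) :=
  TopologicalSpace.generateFrom
    ({U | ∃ V : Set X, IsOpen V ∧ U = {F : ClosedSubset X | ((F : Set X) ∩ V).Nonempty}} ∪
      {U | ∃ K : Set X, IsCompact K ∧ U = {F : ClosedSubset X | (F : Set X) ∩ K = ∅}})

/-- The Borel σ-algebra of the Chabauty-Fell topology. -/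
instance instMeasurableSpace (X : Type*) [TopologicalSpace X] :
    MeasurableSpace (ClosedSubset X) :=
  borel (ClosedSubset X)

instance instBorelSpace (X : Type*) [TopologicalSpace X] : BorelSpace (ClosedSubset X) := ⟨rfl⟩

/-- The action `(g, F) ↦ gF` of a topological group on its closed subsets. -/
instance instMulAction (G : Type*) [Group G] [TopologicalSpace G] [IsTopologicalGroup G] :
    MulAction G (ClosedSubset G) where
  smul g F := ⟨g • (F : Set G), F.isClosed.smul g⟩
  one_smul F := SetLike.coe_injective (one_smul G (F : Set G))
  mul_smul g h F := SetLike.coe_injective (mul_smul g h (F : Set G))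

/-- The intersection `P ∩ H`, as a closed subset of the topological space `H`. -/
def inter {G : Type*} [Group G] [TopologicalSpace G] (P : ClosedSubset G) (H : Subgroup G) :
    ClosedSubset H :=
  ⟨(Subtype.val : H → G) ⁻¹' (P : Set G), P.isClosed.preimage continuous_subtype_val⟩

end ClosedSubset

section Defs

variable {G : Type*} [Group G]

/-- An approximate subgroup: a symmetric subset `Λ` that contains the identity and such that
`Λ²` is covered by finitely many left-translates of `Λ`. -/
def IsApproxSubgroup (Λ : Set G) : Prop := ∃ K : ℝ, IsApproximateSubgroup K Λ

variable [TopologicalSpace G]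

/-- `ΛΛ⁻¹ ∩ V = {e}` for some neighbourhood `V` of the identity. -/
def IsUniformlyDiscrete (Λ : Set G) : Prop :=
  ∃ V ∈ 𝓝 (1 : G), (Λ * Λ⁻¹) ∩ V = {1}

/-- A subset that meets every compact subset in a finite set. -/
def IsLocallyFiniteSubset {X : Type*} [TopologicalSpace X] (S : Set X) : Prop :=
  ∀ K : Set X, IsCompact K → (S ∩ K).Finite

/-- A uniformly discrete and relatively dense approximate subgroup. -/
structure IsUniformApproxLattice (Λ : Set G) : Prop where
  isApproxSubgroup : IsApproxSubgroup Λ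
  isUniformlyDiscrete : IsUniformlyDiscrete Λ
  relativelyDense : ∃ K : Set G, IsCompact K ∧ Λ * K = univ

variable [IsTopologicalGroup G]

theorem IsUniformlyDiscrete.isClosed [T2Space G] {Λ : Set G} (h : IsUniformlyDiscrete Λ) :
    IsClosed Λ := by
  obtain ⟨V, hV, hΛ⟩ := h
  have hdiv : Filter.Tendsto (fun p : G × G => p.1 * p.2⁻¹) (𝓝 (1, 1)) (𝓝 1) := by
    have : Continuous (fun p : G × G => p.1 * p.2⁻¹) := by fun_prop
    simpa using this.tendsto (1, 1)
  rw [nhds_prod_eq] at hdiv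
  obtain ⟨W, hW, hWV⟩ := Filter.mem_prod_same_iff.1 (hdiv hV)
  rw [← closure_subset_iff_isClosed]
  intro x hx
  by_contra hxΛ
  have hN : {y : G | y * x⁻¹ ∈ W} ∈ 𝓝 x := by
    have : Continuous (fun y : G => y * x⁻¹) := by fun_prop
    exact this.continuousAt.preimage_mem_nhds (by simpa using hW)
  obtain ⟨a, haW, haΛ⟩ := mem_closure_iff_nhds.1 hx _ hN
  have hax : x ≠ a := fun h => hxΛ (h ▸ haΛ)
  obtain ⟨b, ⟨hbW, hba⟩, hbΛ⟩ := mem_closure_iff_nhds.1 hx _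
    (Filter.inter_mem hN (isOpen_ne.mem_nhds hax))
  have hab : b * a⁻¹ ∈ (Λ * Λ⁻¹) ∩ V := by
    refine ⟨Set.mul_mem_mul hbΛ (Set.inv_mem_inv.2 haΛ), ?_⟩
    have := hWV (Set.mk_mem_prod hbW haW)
    simpa using this
  rw [hΛ] at hab
  exact hba (mul_inv_eq_one.1 hab)

/-- The invariant hull `Ω_F`: the closure of the `G`-orbit of the closed subset `F` of `G` for the
Chabauty-Fell topology. -/
def invariantHull (F : ClosedSubset G) : Set (ClosedSubset G) :=
  closure (MulAction.orbit G F)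

/-- There is a proper `G`-invariant Borel probability measure on `Ω_F`. A Borel probability measure
on the closed subset `Ω_F` of `𝒞(G)` is the same thing as a Borel probability measure on `𝒞(G)` that
gives full mass to `Ω_F`; it is proper if `{∅}` is a null set. -/
def HasProperInvariantMeasure (F : ClosedSubset G) : Prop :=
  ∃ ν : Measure (ClosedSubset G), IsProbabilityMeasure ν ∧ SMulInvariantMeasure G (ClosedSubset G) ν ∧
    ν (invariantHull F)ᶜ = 0 ∧ ν {P : ClosedSubset G | (P : Set G) = ∅} = 0

/-- A uniformly discrete approximate subgroup whose invariant hull carries a proper invariant Borel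
probability measure. -/
structure IsStrongApproxLattice [T2Space G] (Λ : Set G) : Prop where
  isApproxSubgroup : IsApproxSubgroup Λ
  isUniformlyDiscrete : IsUniformlyDiscrete Λ
  hasProperInvariantMeasure :
    HasProperInvariantMeasure (⟨Λ, isUniformlyDiscrete.isClosed⟩ : ClosedSubset G)

/-- The left-translate `x ↦ f (g⁻¹ x)` of a bounded continuous function. -/
def leftTranslate (g : G) (f : G →ᵇ ℝ) : G →ᵇ ℝ :=
  f.compContinuous ⟨fun x => g⁻¹ * x, by fun_prop⟩

/-- Amenability of a locally compact group: there is a left-invariant mean on the bounded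
continuous real functions. -/
def IsAmenableGroup (G : Type*) [Group G] [TopologicalSpace G] [IsTopologicalGroup G] : Prop :=
  ∃ m : (G →ᵇ ℝ) →ₗ[ℝ] ℝ,
    (∀ f : G →ᵇ ℝ, (∀ x, 0 ≤ f x) → 0 ≤ m f) ∧
    m (BoundedContinuousFunction.const G 1) = 1 ∧
    ∀ (g : G) (f : G →ᵇ ℝ), m (leftTranslate g f) = m f

end Defs

/-! Write `p` for the map from `G` to `G ⧸ H`.

Uniform case. If `x ∈ H` is `l * k` with `l ∈ Λ` and `k ∈ K`, then `l⁻¹` and `k` have the same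
image, which lies in the finite set `p(Λ) ∩ p(K)`. Correcting `l` on the right by one of finitely
many representatives `f ∈ Λ` gives `x = (l * f) * (f⁻¹ * k)`, with `l * f ∈ Λ² ∩ H` and the second
factor in a fixed compact set.

Strong case. A proper `G`-invariant measure `ν` on the hull of `Λ` is disintegrated over the
`H`-invariant Borel sets. For almost every `P` the conditional measure is `H`-invariant, is carried
by the closure of the orbit `H • P`, and gives full mass to each `H`-stable open set containing `P`
(`ae_exists_smulInvariantMeasure_closure_orbit`). Fix such a nonempty `P` and `g ∈ P`. Then `g⁻¹ •
P` contains `1` and lies in `Λ²`. Since `p(Λ²)` is locally finite, the coset `H` is isolated in it,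
so `Q ↦ (g⁻¹ • Q) ∩ H` is continuous on the orbit closure (`ClosedSubset.continuousOn_inter`).
Pushing the conditional measure forward along it gives a proper `H`-invariant measure on the hull of
`(g⁻¹ • P) ∩ H`.

Amenable case. That intersection is contained in `Λ² ∩ H`, so it suffices that properness passes to
larger closed sets (`HasProperInvariantMeasure.mono`). The measure on the small hull is a positive
functional on orbit functions of the small set. It extends to all bounded continuous functions on
the group, is evaluated on orbit functions of the large set, and is averaged by the invariant mean.
A monotone test function vanishing at `∅` shows that the resulting measure is not the point mass at
`∅`. -/

namespace ClosedSubset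

/-! ### The Chabauty-Fell topology: compact, metrizable, with continuous group action -/

section Topology

variable {X : Type*} [TopologicalSpace X]

theorem isOpen_setOf_inter_nonempty {V : Set X} (hV : IsOpen V) :
    IsOpen {F : ClosedSubset X | ((F : Set X) ∩ V).Nonempty} :=
  TopologicalSpace.isOpen_generateFrom_of_mem (Or.inl ⟨V, hV, rfl⟩)

theorem isOpen_setOf_inter_eq_empty {K : Set X} (hK : IsCompact K) :
    IsOpen {F : ClosedSubset X | (F : Set X) ∩ K = ∅} :=
  TopologicalSpace.isOpen_generateFrom_of_mem (Or.inr ⟨K, hK, rfl⟩)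

theorem isClosed_setOf_subset {C : Set X} (hC : IsClosed C) :
    IsClosed {F : ClosedSubset X | (F : Set X) ⊆ C} := by
  rw [← isOpen_compl_iff]
  convert isOpen_setOf_inter_nonempty hC.isOpen_compl using 1
  ext F
  simp [Set.not_subset, Set.Nonempty]

theorem setOf_eq_empty_compl :
    {P : ClosedSubset X | (P : Set X) = ∅}ᶜ =
      {F : ClosedSubset X | ((F : Set X) ∩ univ).Nonempty} := by
  ext F
  simp [Set.nonempty_iff_ne_empty]

theorem measurableSet_setOf_eq_empty : MeasurableSet {P : ClosedSubset X | (P : Set X) = ∅} := by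
  rw [← MeasurableSet.compl_iff, setOf_eq_empty_compl]
  exact (isOpen_setOf_inter_nonempty isOpen_univ).measurableSet

/-- By Alexander's subbase theorem. Let `W` be the union of the open sets `V` whose hitting sets
occur in the cover. The closed set `Wᶜ` lies in none of these hitting sets, so it is covered by a
missing set of some compact `K`. Then `K ⊆ W`, and finitely many `V` cover `K`. -/
instance instCompactSpace : CompactSpace (ClosedSubset X) := by
  refine compactSpace_generateFrom rfl fun P hP hcov => ?_
  let W : Set X := ⋃₀ {V | IsOpen V ∧ {F : ClosedSubset X | ((F : Set X) ∩ V).Nonempty} ∈ P}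
  have hW : IsOpen W := isOpen_sUnion fun V hV => hV.1
  let F₀ : ClosedSubset X := ⟨Wᶜ, hW.isClosed_compl⟩
  have hF₀ : (F₀ : Set X) = Wᶜ := rfl
  obtain ⟨U, hUP, hFU⟩ : F₀ ∈ ⋃₀ P := hcov ▸ mem_univ _
  rcases hP hUP with ⟨V, hV, rfl⟩ | ⟨K, hK, rfl⟩
  · obtain ⟨x, hx, hxV⟩ := hFU
    exact absurd (show x ∈ W from ⟨V, ⟨hV, hUP⟩, hxV⟩) hx
  · have hKW : K ⊆ W := by
      intro x hx
      by_contra hxW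
      have : x ∈ (F₀ : Set X) ∩ K := ⟨hxW, hx⟩
      rw [show (F₀ : Set X) ∩ K = ∅ from hFU] at this
      exact this
    obtain ⟨T, hT, hTfin, hKT⟩ := hK.elim_finite_subcover_image (c := id)
      (b := {V | IsOpen V ∧ {F : ClosedSubset X | ((F : Set X) ∩ V).Nonempty} ∈ P})
      (fun V hV => hV.1) (by simpa [W, sUnion_eq_biUnion] using hKW)
    refine ⟨insert {F : ClosedSubset X | (F : Set X) ∩ K = ∅}
      ((fun V : Set X => {F : ClosedSubset X | ((F : Set X) ∩ V).Nonempty}) '' T), ?_,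
      (hTfin.image _).insert _, ?_⟩
    · rintro _ (rfl | ⟨V, hV, rfl⟩)
      exacts [hUP, (hT hV).2]
    · refine eq_univ_of_forall fun F => ?_
      by_cases h : (F : Set X) ∩ K = ∅
      · exact ⟨_, mem_insert _ _, h⟩
      · obtain ⟨x, hxF, hxK⟩ := Set.nonempty_iff_ne_empty.2 h
        obtain ⟨V, hV, hxV⟩ := mem_iUnion₂.1 (hKT hxK)
        exact ⟨_, mem_insert_of_mem _ ⟨V, hV, rfl⟩, x, hxF, hxV⟩

instance instT2Space [T2Space X] [LocallyCompactSpace X] : T2Space (ClosedSubset X) := by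
  have key : ∀ F F' : ClosedSubset X, ¬ (F : Set X) ⊆ F' →
      ∃ u v : Set (ClosedSubset X), IsOpen u ∧ IsOpen v ∧ F ∈ u ∧ F' ∈ v ∧ Disjoint u v := by
    intro F F' h
    obtain ⟨x, hxF, hxF'⟩ := Set.not_subset.1 h
    obtain ⟨K, hK, hxK, hKF⟩ :=
      exists_compact_subset F'.isClosed.isOpen_compl (show x ∈ (F' : Set X)ᶜ from hxF')
    refine ⟨_, _, isOpen_setOf_inter_nonempty isOpen_interior, isOpen_setOf_inter_eq_empty hK,
      ⟨x, hxF, hxK⟩, ?_, ?_⟩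
    · exact Set.disjoint_iff_inter_eq_empty.1 (Set.disjoint_left.2 fun y hy hyK => hKF hyK hy)
    · refine Set.disjoint_left.2 fun E ⟨y, hy, hyK⟩ hE => ?_
      have : y ∈ (E : Set X) ∩ K := ⟨hy, interior_subset hyK⟩
      rw [show (E : Set X) ∩ K = ∅ from hE] at this
      exact this
  refine ⟨fun F F' hne => ?_⟩
  by_cases h : (F : Set X) ⊆ F'
  · have h' : ¬ (F' : Set X) ⊆ F := fun h' => hne (SetLike.coe_injective (h.antisymm h'))
    obtain ⟨u, v, hu, hv, h1, h2, h3⟩ := key F' F h'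
    exact ⟨v, u, hv, hu, h2, h1, h3.symm⟩
  · exact key F F' h

instance instSecondCountableTopology [T2Space X] [LocallyCompactSpace X]
    [SecondCountableTopology X] : SecondCountableTopology (ClosedSubset X) := by
  let B := TopologicalSpace.countableBasis X
  have hB : TopologicalSpace.IsTopologicalBasis B := TopologicalSpace.isBasis_countableBasis X
  let 𝒮 : Set (Set (ClosedSubset X)) :=
    (fun V : Set X => {F : ClosedSubset X | ((F : Set X) ∩ V).Nonempty}) '' B ∪
      (fun V : Set X => {F : ClosedSubset X | (F : Set X) ∩ closure V = ∅}) ''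
        {V ∈ B | IsCompact (closure V)}
  have hc : 𝒮.Countable := ((TopologicalSpace.countable_countableBasis X).image _).union
    (((TopologicalSpace.countable_countableBasis X).mono (sep_subset _ _)).image _)
  refine ⟨𝒮, hc, le_antisymm ?_ ?_⟩
  · refine le_generateFrom ?_
    rintro _ (⟨V, hV, rfl⟩ | ⟨V, ⟨-, hV⟩, rfl⟩)
    exacts [isOpen_setOf_inter_nonempty (hB.isOpen hV), isOpen_setOf_inter_eq_empty hV]
  · refine le_generateFrom ?_
    let := TopologicalSpace.generateFrom 𝒮
    rintro _ (⟨V, hV, rfl⟩ | ⟨K, hK, rfl⟩)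
    · have : {F : ClosedSubset X | ((F : Set X) ∩ V).Nonempty} =
          ⋃ U ∈ {U ∈ B | U ⊆ V}, {F : ClosedSubset X | ((F : Set X) ∩ U).Nonempty} := by
        ext F
        simp only [mem_ofPred_eq, mem_iUnion, exists_prop]
        constructor
        · rintro ⟨x, hxF, hxV⟩
          obtain ⟨U, hU, hxU, hUV⟩ := hB.exists_subset_of_mem_open hxV hV
          exact ⟨U, ⟨hU, hUV⟩, x, hxF, hxU⟩
        · rintro ⟨U, ⟨-, hUV⟩, x, hxF, hxU⟩
          exact ⟨x, hxF, hUV hxU⟩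
      rw [this]
      exact isOpen_biUnion fun U hU =>
        TopologicalSpace.isOpen_generateFrom_of_mem (Or.inl ⟨U, hU.1, rfl⟩)
    · refine isOpen_iff_forall_mem_open.2 fun F hF => ?_
      have hloc : ∀ x ∈ K, ∃ U ∈ {U ∈ B | IsCompact (closure U) ∧ closure U ⊆ (F : Set X)ᶜ},
          x ∈ U := by
        intro x hx
        have hxF : x ∈ (F : Set X)ᶜ := fun h => by
          have : x ∈ (F : Set X) ∩ K := ⟨h, hx⟩
          rw [show (F : Set X) ∩ K = ∅ from hF] at this
          exact this
        obtain ⟨C, hC, hxC, hCF⟩ := exists_compact_subset F.isClosed.isOpen_compl hxF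
        obtain ⟨U, hU, hxU, hUC⟩ := hB.exists_subset_of_mem_open hxC isOpen_interior
        have hcl : closure U ⊆ C := closure_minimal (hUC.trans interior_subset) hC.isClosed
        exact ⟨U, ⟨hU, hC.of_isClosed_subset isClosed_closure hcl, hcl.trans hCF⟩, hxU⟩
      obtain ⟨T, hT, hTfin, hKT⟩ := hK.elim_finite_subcover_image (c := id)
        (b := {U ∈ B | IsCompact (closure U) ∧ closure U ⊆ (F : Set X)ᶜ})
        (fun V hV => hB.isOpen hV.1) (fun x hx => mem_iUnion₂.2 (by simpa using hloc x hx))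
      refine ⟨⋂ U ∈ T, {E : ClosedSubset X | (E : Set X) ∩ closure U = ∅}, ?_, ?_, ?_⟩
      · intro E hE
        refine Set.eq_empty_of_forall_notMem fun x ⟨hxE, hxK⟩ => ?_
        obtain ⟨U, hU, hxU⟩ := mem_iUnion₂.1 (hKT hxK)
        have h1 : (E : Set X) ∩ closure U = ∅ := mem_iInter₂.1 hE U hU
        have : x ∈ (E : Set X) ∩ closure U := ⟨hxE, subset_closure hxU⟩
        rw [h1] at this
        exact this
      · exact hTfin.isOpen_biInter fun U hU =>
          TopologicalSpace.isOpen_generateFrom_of_mem (Or.inr ⟨U, ⟨(hT hU).1, (hT hU).2.1⟩, rfl⟩)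
      · exact mem_iInter₂.2 fun U hU => Set.disjoint_iff_inter_eq_empty.1
          (Set.disjoint_left.2 fun y hy hyU => (hT hU).2.2 hyU hy)

instance instMetrizableSpace [T2Space X] [LocallyCompactSpace X] [SecondCountableTopology X] :
    TopologicalSpace.MetrizableSpace (ClosedSubset X) :=
  TopologicalSpace.metrizableSpace_of_t3_secondCountable _

instance instPolishSpace [T2Space X] [LocallyCompactSpace X] [SecondCountableTopology X] :
    PolishSpace (ClosedSubset X) := by
  let := TopologicalSpace.metrizableSpaceMetric (ClosedSubset X)
  exact inferInstance

end Topology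

section Action

variable {G : Type*} [Group G] [TopologicalSpace G] [IsTopologicalGroup G]

theorem coe_smul (g : G) (F : ClosedSubset G) :
    ((g • F : ClosedSubset G) : Set G) = g • (F : Set G) :=
  rfl

omit [IsTopologicalGroup G] in
theorem coe_inter (P : ClosedSubset G) (H : Subgroup G) :
    ((P.inter H : ClosedSubset H) : Set H) = (Subtype.val : H → G) ⁻¹' (P : Set G) :=
  rfl

theorem smul_inter (H : Subgroup G) (h : H) (P : ClosedSubset G) :
    ((h : G) • P).inter H = h • P.inter H := by
  refine SetLike.coe_injective ?_
  ext x
  simp [coe_inter, coe_smul, Set.mem_smul_set_iff_inv_smul_mem]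

instance instContinuousSMul [LocallyCompactSpace G] : ContinuousSMul G (ClosedSubset G) := by
  refine ⟨continuous_generateFrom_iff.2 ?_⟩
  rintro _ (⟨V, hV, rfl⟩ | ⟨K, hK, rfl⟩)
  · refine isOpen_iff_mem_nhds.2 ?_
    rintro ⟨g, F⟩ ⟨_, ⟨x, hx, rfl⟩, hxV⟩
    have hcont : Continuous fun p : G × G => p.1 * p.2 := continuous_mul
    have hmem : (fun p : G × G => p.1 * p.2) ⁻¹' V ∈ 𝓝 (g, x) :=
      hcont.continuousAt.preimage_mem_nhds (hV.mem_nhds hxV)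
    obtain ⟨A, B, hA, hgA, hB, hxB, hAB⟩ := mem_nhds_prod_iff'.1 hmem
    refine Filter.mem_of_superset (prod_mem_nhds (hA.mem_nhds hgA)
      ((isOpen_setOf_inter_nonempty hB).mem_nhds ⟨x, hx, hxB⟩)) ?_
    rintro ⟨g', F'⟩ ⟨hg', y, hy, hyB⟩
    exact ⟨g' • y, Set.smul_mem_smul_set hy, hAB (mk_mem_prod hg' hyB)⟩
  · refine isOpen_iff_mem_nhds.2 ?_
    rintro ⟨g, F⟩ (hF : g • (F : Set G) ∩ K = ∅)
    have hsub : ({g} : Set G) ×ˢ K ⊆ (fun p : G × G => p.1⁻¹ * p.2) ⁻¹' (F : Set G)ᶜ := by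
      rintro ⟨a, k⟩ ⟨rfl, hk⟩ hak
      have : k ∈ a • (F : Set G) ∩ K := ⟨Set.mem_smul_set_iff_inv_smul_mem.2 hak, hk⟩
      rw [hF] at this
      exact this
    obtain ⟨A, B, hA, hB, hgA, hKB, hAB⟩ := generalized_tube_lemma (isCompact_singleton (x := g)) hK
      (F.isClosed.isOpen_compl.preimage (by fun_prop)) hsub
    -- For every `g'` in the compact neighbourhood `N`, `g' • F'` misses `K` as soon as `F'` misses
    -- the compact set `N⁻¹ * K`.
    obtain ⟨N, hN, hgN, hNA⟩ := exists_compact_subset hA (hgA rfl)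
    refine Filter.mem_of_superset (prod_mem_nhds (mem_interior_iff_mem_nhds.1 hgN)
      ((isOpen_setOf_inter_eq_empty (hN.inv.mul hK)).mem_nhds ?_)) ?_
    · refine Set.disjoint_iff_inter_eq_empty.1 (Set.disjoint_left.2 ?_)
      rintro _ hy ⟨n, hn, k, hk, rfl⟩
      have := hAB (mk_mem_prod (hNA hn) (hKB hk))
      simp only [mem_preimage, inv_inv] at this
      exact this hy
    · rintro ⟨g', F'⟩ ⟨hg', (hF' : (F' : Set G) ∩ (N⁻¹ * K) = ∅)⟩
      refine Set.eq_empty_of_forall_notMem ?_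
      rintro k ⟨hk, hkK⟩
      have : g'⁻¹ * k ∈ (F' : Set G) ∩ (N⁻¹ * K) :=
        ⟨Set.mem_smul_set_iff_inv_smul_mem.1 hk,
          Set.mul_mem_mul (Set.inv_mem_inv.2 hg') hkK⟩
      rw [hF'] at this
      exact this

end Action

end ClosedSubset

/-! ### Invariant measures and disintegration over the invariant sets -/

theorem MeasurableSpace.exists_countable_isPiSystem_generateFrom (X : Type*)
    [mX : MeasurableSpace X]
    [MeasurableSpace.CountablyGenerated X] :
    ∃ C : Set (Set X), C.Countable ∧ IsPiSystem C ∧ mX = MeasurableSpace.generateFrom C := by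
  obtain ⟨B, hB, rfl⟩ := MeasurableSpace.CountablyGenerated.isCountablyGenerated (α := X)
  refine ⟨(fun T => ⋂₀ T) '' {T | T.Finite ∧ T ⊆ B},
    (Set.countable_ofPred_finite_subset hB).image _, ?_, le_antisymm ?_ ?_⟩
  · rintro _ ⟨S, hS, rfl⟩ _ ⟨T, hT, rfl⟩ -
    exact ⟨S ∪ T, ⟨hS.1.union hT.1, union_subset hS.2 hT.2⟩, sInter_union S T⟩
  · refine MeasurableSpace.generateFrom_mono fun s hs => ⟨{s}, ?_, sInter_singleton s⟩
    exact ⟨finite_singleton s, singleton_subset_iff.2 hs⟩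
  · refine MeasurableSpace.generateFrom_le ?_
    rintro _ ⟨T, hT, rfl⟩
    exact MeasurableSet.sInter hT.1.countable fun t ht =>
      MeasurableSpace.measurableSet_generateFrom (hT.2 ht)

/-- By dominated convergence `g ↦ ∫ f (g • x)` is continuous for bounded continuous `f`, so the
elements preserving the integral of `f` form a closed set. -/
theorem smulInvariantMeasure_of_dense {H X : Type*} [Group H] [MulAction H X]
    [TopologicalSpace H] [SecondCountableTopology H] [TopologicalSpace X] [MeasurableSpace X]
    [PolishSpace X] [BorelSpace X] [ContinuousSMul H X] (κ : Measure X)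
    [IsProbabilityMeasure κ] {D : Set H}
    (hD : Dense D) (h : ∀ d ∈ D, κ.map (d • ·) = κ) :
    SMulInvariantMeasure H X κ := by
  have hmeas : ∀ g : H, Measurable (g • · : X → X) := fun g =>
    (continuous_const_smul g).measurable
  have hint : ∀ (f : X →ᵇ ℝ) (g : H), ∫ x, f (g • x) ∂κ = ∫ x, f x ∂κ := by
    intro f
    have hcont : Continuous fun g : H => ∫ x, f (g • x) ∂κ := by
      refine continuous_of_dominated (bound := fun _ => ‖f‖)
        (fun g => (f.continuous.measurable.comp (hmeas g)).aestronglyMeasurable)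
        (fun g => ae_of_all _ fun x => f.norm_coe_le_norm _) (integrable_const _)
        (ae_of_all _ fun x => f.continuous.comp (continuous_id.smul continuous_const))
    have hclosed : IsClosed {g : H | ∫ x, f (g • x) ∂κ = ∫ x, f x ∂κ} :=
      isClosed_eq hcont continuous_const
    intro g
    refine closure_minimal (fun d hd => ?_) hclosed (hD g)
    have := integral_map (μ := κ) (hmeas d).aemeasurable (f := f)
      f.continuous.aestronglyMeasurable
    rw [h d hd] at this
    exact this.symm
  refine ⟨fun g s hs => ?_⟩
  have : κ.map (g • ·) = κ := by
    have := Measure.isProbabilityMeasure_map (μ := κ) (hmeas g).aemeasurable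
    refine ext_of_forall_integral_eq_of_IsFiniteMeasure fun f => ?_
    rw [integral_map (hmeas g).aemeasurable f.continuous.aestronglyMeasurable]
    exact hint f g
  rw [← Measure.map_apply (hmeas g) hs, this]

section ErgodicDecomposition

variable (H : Type*) {X : Type*} [Group H] [MulAction H X]

/-- The `σ`-algebra of the measurable sets that are invariant under a group action. -/
@[reducible] def invariantMeasurableSpace [MeasurableSpace X] : MeasurableSpace X where
  MeasurableSet' A := MeasurableSet A ∧ ∀ h : H, (h • · : X → X) ⁻¹' A = A
  measurableSet_empty := ⟨MeasurableSet.empty, fun _ => rfl⟩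
  measurableSet_compl A hA := ⟨hA.1.compl, fun h => by rw [preimage_compl, hA.2 h]⟩
  measurableSet_iUnion f hf := ⟨MeasurableSet.iUnion fun i => (hf i).1, fun h => by
    rw [preimage_iUnion]; exact iUnion_congr fun i => (hf i).2 h⟩

theorem invariantMeasurableSpace_le [mX : MeasurableSpace X] :
    invariantMeasurableSpace H (X := X) ≤ mX :=
  fun _ hA => hA.1

open ProbabilityTheory

variable [mX : MeasurableSpace X] [StandardBorelSpace X]

/-- The indicator of an invariant set is its own conditional expectation. -/
theorem ae_condExpKernel_compl_eq_zero (ν : Measure X) [IsProbabilityMeasure ν] {A : Set X}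
    (hA : MeasurableSet[invariantMeasurableSpace H] A) :
    ∀ᵐ x ∂ν, x ∈ A → condExpKernel ν (invariantMeasurableSpace H) x Aᶜ = 0 := by
  have hm := invariantMeasurableSpace_le H (X := X)
  have h1 := condExpKernel_ae_eq_condExp (μ := ν) hm hA.1.compl
  have h2 : ν⟦Aᶜ | invariantMeasurableSpace H⟧ = Aᶜ.indicator fun _ => (1 : ℝ) :=
    condExp_of_stronglyMeasurable hm
      (stronglyMeasurable_const.indicator (MeasurableSet.compl hA))
      ((integrable_const _).indicator hA.1.compl)
  filter_upwards [h1] with x hx hxA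
  rw [h2] at hx
  have : (condExpKernel ν (invariantMeasurableSpace H) x).real Aᶜ = 0 := by
    rw [hx]; simp [hxA]
  exact (measureReal_eq_zero_iff).1 this

theorem ae_condExpKernel_preimage_smul [MeasurableConstSMul H X] (ν : Measure X)
    [IsProbabilityMeasure ν] [SMulInvariantMeasure H X ν] (h : H) {s : Set X}
    (hs : MeasurableSet s) :
    ∀ᵐ x ∂ν, condExpKernel ν (invariantMeasurableSpace H) x ((h • ·) ⁻¹' s) =
      condExpKernel ν (invariantMeasurableSpace H) x s := by
  have hm := invariantMeasurableSpace_le H (X := X)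
  have hs' : MeasurableSet ((h • · : X → X) ⁻¹' s) := measurable_const_smul h hs
  have key : ν⟦(h • · : X → X) ⁻¹' s | invariantMeasurableSpace H⟧ =ᵐ[ν]
      ν⟦s | invariantMeasurableSpace H⟧ := by
    refine (ae_eq_condExp_of_forall_setIntegral_eq hm ((integrable_const _).indicator hs')
      (fun _ _ _ => integrable_condExp.integrableOn) (fun A hA _ => ?_)
      stronglyMeasurable_condExp.aestronglyMeasurable).symm
    rw [setIntegral_condExp hm ((integrable_const _).indicator hs) hA,
      setIntegral_indicator hs, setIntegral_indicator hs']
    have : A ∩ (h • · : X → X) ⁻¹' s = (h • · : X → X) ⁻¹' (A ∩ s) := by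
      rw [preimage_inter, hA.2 h]
    have hν : ν ((h • · : X → X) ⁻¹' (A ∩ s)) = ν (A ∩ s) := measure_preimage_smul ν h _
    simp only [measureReal_def, this, hν, smul_eq_mul, mul_one, integral_const,
      Measure.restrict_apply, MeasurableSet.univ, univ_inter]
  filter_upwards [condExpKernel_ae_eq_condExp (μ := ν) hm hs,
    condExpKernel_ae_eq_condExp (μ := ν) hm hs', key] with x h1 h2 h3
  exact (measureReal_eq_measureReal_iff).1 (h2.trans (h3.trans h1.symm))

variable [TopologicalSpace X] [PolishSpace X] [BorelSpace X] [TopologicalSpace H]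
  [SecondCountableTopology H] [ContinuousSMul H X]

/-- The conditional measure at `x` works. Invariance has to be tested only on a countable dense set
of group elements and a countable π-system, so the exceptional null sets can be united. The
saturation `S V` of a basic open set is invariant, so almost surely the conditional measure is
carried by `S V` or by its complement, according to the position of `x`. The orbit closure of `x` is
the complement of the union of those `S V` that do not contain `x`. -/
theorem ae_exists_smulInvariantMeasure_closure_orbit (ν : Measure X)
    [IsProbabilityMeasure ν] [SMulInvariantMeasure H X ν] :
    ∀ᵐ x ∂ν, ∃ κ : Measure X, IsProbabilityMeasure κ ∧ SMulInvariantMeasure H X κ ∧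
      κ (closure (MulAction.orbit H x))ᶜ = 0 ∧
      ∀ U : Set X, IsOpen U → x ∈ U → (∀ h : H, ∀ y ∈ U, h • y ∈ U) → κ Uᶜ = 0 := by
  obtain ⟨D, hDc, hD⟩ := TopologicalSpace.exists_countable_dense H
  obtain ⟨C, hCc, hCpi, hC⟩ := MeasurableSpace.exists_countable_isPiSystem_generateFrom X
  let B := TopologicalSpace.countableBasis X
  have hBc : B.Countable := TopologicalSpace.countable_countableBasis X
  have hB : TopologicalSpace.IsTopologicalBasis B := TopologicalSpace.isBasis_countableBasis X
  let S : Set X → Set X := fun V => ⋃ h : H, (h • · : X → X) ⁻¹' V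
  have hSo : ∀ V ∈ B, IsOpen (S V) := fun V hV =>
    isOpen_iUnion fun h => (hB.isOpen hV).preimage (continuous_const_smul h)
  have hSi : ∀ V ∈ B, MeasurableSet[invariantMeasurableSpace H] (S V) := by
    refine fun V hV => ⟨(hSo V hV).measurableSet, fun g => ?_⟩
    ext x
    simp only [S, mem_preimage, mem_iUnion, smul_smul]
    exact ⟨fun ⟨h, hx⟩ => ⟨h * g, hx⟩, fun ⟨h, hx⟩ => ⟨h * g⁻¹, by simpa using hx⟩⟩
  have hVS : ∀ V, V ⊆ S V := fun V x hx => mem_iUnion.2 ⟨1, by simpa using hx⟩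
  have h1 : ∀ᵐ x ∂ν, ∀ d ∈ D, ∀ s ∈ C,
      condExpKernel ν (invariantMeasurableSpace H) x ((d • ·) ⁻¹' s) =
        condExpKernel ν (invariantMeasurableSpace H) x s := by
    refine (ae_ball_iff hDc).2 fun d _ => (ae_ball_iff hCc).2 fun s hs => ?_
    refine ae_condExpKernel_preimage_smul H ν d ?_
    rw [hC]
    exact MeasurableSpace.measurableSet_generateFrom hs
  have h2 : ∀ᵐ x ∂ν, ∀ V ∈ B, x ∈ S V →
      condExpKernel ν (invariantMeasurableSpace H) x (S V)ᶜ = 0 :=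
    (ae_ball_iff hBc).2 fun V hV => ae_condExpKernel_compl_eq_zero H ν (hSi V hV)
  have h3 : ∀ᵐ x ∂ν, ∀ V ∈ B, x ∈ (S V)ᶜ →
      condExpKernel ν (invariantMeasurableSpace H) x (S V)ᶜᶜ = 0 :=
    (ae_ball_iff hBc).2 fun V hV =>
      ae_condExpKernel_compl_eq_zero H ν (MeasurableSet.compl (hSi V hV))
  filter_upwards [h1, h2, h3] with x hx1 hx2 hx3
  refine ⟨condExpKernel ν (invariantMeasurableSpace H) x, inferInstance,
    smulInvariantMeasure_of_dense _ hD fun d hd => ?_, ?_, ?_⟩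
  · have hd' : Measurable (d • · : X → X) := measurable_const_smul d
    refine ext_of_generate_finite C hC hCpi (fun s hs => ?_) ?_
    · rw [Measure.map_apply hd' (hC ▸ MeasurableSpace.measurableSet_generateFrom hs)]
      exact hx1 d hd s hs
    · rw [Measure.map_apply hd' MeasurableSet.univ, preimage_univ]
  · refine measure_mono_null (t := ⋃ V ∈ {V ∈ B | x ∉ S V}, S V) ?_ ?_
    · intro y hy
      obtain ⟨V, hV, hyV, hVx⟩ := hB.exists_subset_of_mem_open hy isClosed_closure.isOpen_compl
      refine mem_biUnion (x := V) ⟨hV, fun hxV => ?_⟩ (hVS V hyV)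
      obtain ⟨h, hh⟩ := mem_iUnion.1 hxV
      exact hVx hh (subset_closure ⟨h, rfl⟩)
    · refine (measure_biUnion_null_iff (hBc.mono (sep_subset _ _))).2 fun V hV => ?_
      simpa using hx3 V hV.1 hV.2
  · intro U hU hxU hinv
    obtain ⟨V, hV, hxV, hVU⟩ := hB.exists_subset_of_mem_open hxU hU
    refine measure_mono_null (compl_subset_compl.2 ?_) (hx2 V hV (hVS V hxV))
    intro y hy
    obtain ⟨h, hh⟩ := mem_iUnion.1 hy
    simpa using hinv h⁻¹ _ (hVU hh)

end ErgodicDecomposition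

/-! ### Locally finite sets, approximate subgroups and the uniform case -/

namespace IsLocallyFiniteSubset

variable {X : Type*} [TopologicalSpace X] {S T : Set X}

theorem mono (hT : IsLocallyFiniteSubset T) (h : S ⊆ T) : IsLocallyFiniteSubset S :=
  fun K hK => (hT K hK).subset (inter_subset_inter_left K h)

theorem exists_isOpen [T2Space X] [LocallyCompactSpace X] (hS : IsLocallyFiniteSubset S) (x : X) :
    ∃ U : Set X, IsOpen U ∧ x ∈ U ∧ S ∩ U ⊆ {x} := by
  obtain ⟨K, hK, hxK⟩ := exists_compact_mem_nhds x
  have hfin : ((S ∩ K) \ {x}).Finite := (hS K hK).sdiff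
  refine ⟨interior K \ ((S ∩ K) \ {x}), isOpen_interior.sdiff hfin.isClosed,
    ⟨mem_interior_iff_mem_nhds.2 hxK, fun h => h.2 rfl⟩, ?_⟩
  rintro y ⟨hyS, hyK, hy⟩
  by_contra hyx
  exact hy ⟨⟨hyS, interior_subset hyK⟩, hyx⟩

theorem isClosed [T2Space X] [LocallyCompactSpace X] (hS : IsLocallyFiniteSubset S) :
    IsClosed S := by
  rw [← isOpen_compl_iff, isOpen_iff_forall_mem_open]
  intro x hx
  obtain ⟨U, hU, hxU, hSU⟩ := hS.exists_isOpen x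
  refine ⟨U, fun y hyU hyS => hx ?_, hU, hxU⟩
  rwa [← (hSU ⟨hyS, hyU⟩ : y = x)]

theorem finite_mul {G : Type*} [Group G] [TopologicalSpace G] [IsTopologicalGroup G]
    {F S : Set G} (hF : F.Finite) (hS : IsLocallyFiniteSubset S) :
    IsLocallyFiniteSubset (F * S) := by
  intro K hK
  refine (hF.biUnion (t := fun a => (a * ·) '' (S ∩ a⁻¹ • K))
    fun a _ => (hS _ (hK.smul a⁻¹)).image _).subset ?_
  rintro _ ⟨⟨a, ha, s, hs, rfl⟩, hk⟩
  exact mem_biUnion ha ⟨s, ⟨hs, by simpa [Set.mem_smul_set_iff_inv_smul_mem] using hk⟩, rfl⟩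

end IsLocallyFiniteSubset

section ApproxSubgroup

variable {G : Type*} [Group G] {Λ : Set G}

theorem IsApproxSubgroup.one_mem (hΛ : IsApproxSubgroup Λ) : (1 : G) ∈ Λ :=
  hΛ.choose_spec.one_mem

theorem IsApproxSubgroup.inv_eq_self (hΛ : IsApproxSubgroup Λ) : Λ⁻¹ = Λ :=
  hΛ.choose_spec.inv_eq_self

theorem IsApproxSubgroup.inv_mem (hΛ : IsApproxSubgroup Λ) {x : G} (hx : x ∈ Λ) : x⁻¹ ∈ Λ := by
  rw [← hΛ.inv_eq_self]
  exact Set.inv_mem_inv.2 hx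

theorem IsApproxSubgroup.sq_inv_mem (hΛ : IsApproxSubgroup Λ) {x : G} (hx : x ∈ Λ ^ 2) :
    x⁻¹ ∈ Λ ^ 2 := by
  have : (Λ ^ 2)⁻¹ = Λ ^ 2 := by rw [← inv_pow, hΛ.inv_eq_self]
  rw [← this]
  exact Set.inv_mem_inv.2 hx

theorem IsApproxSubgroup.exists_finite_pow_subset (hΛ : IsApproxSubgroup Λ) {n : ℕ} (hn : n ≠ 0) :
    ∃ F : Set G, F.Finite ∧ Λ ^ n ⊆ F * Λ := by
  classical
  obtain ⟨K, hK⟩ := hΛ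
  obtain ⟨F, -, hF⟩ := hK.sq_covBySMul
  refine ⟨(F : Set G) ^ (n - 1), ?_, pow_subset_pow_mul_of_sq_subset_mul hF hn⟩
  rw [← Finset.coe_pow]
  exact Finset.finite_toSet _

/-- The square of `Λ² ∩ H` lies in `Λ⁴ ∩ H`, which finitely many translates of `Λ² ∩ H` cover. -/
theorem IsApproxSubgroup.comap_sq (hΛ : IsApproxSubgroup Λ) (H : Subgroup G) :
    IsApproxSubgroup ((Subtype.val : H → G) ⁻¹' (Λ ^ 2)) := by
  classical
  obtain ⟨K, hK⟩ := id hΛ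
  have hH : (H : Set G) ^ 2 = H := by simp [sq]
  obtain ⟨F, hF⟩ := hK.pow_inter_pow_covBySMul_sq_inter_sq
    (IsApproximateSubgroup.subgroup (H := H)) (m := 4) (n := 2) (by norm_num) le_rfl
  rw [hH] at hF
  let E : Finset H := F.preimage Subtype.val Subtype.val_injective.injOn
  refine ⟨E.card, ⟨Set.one_mem_pow hΛ.one_mem, ?_, E, le_rfl, ?_⟩⟩
  · ext x
    exact ⟨fun hx => by simpa using hΛ.sq_inv_mem hx, fun hx => by simpa using hΛ.sq_inv_mem hx⟩
  · rw [sq, smul_eq_mul]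
    rintro _ ⟨x, hx, y, hy, rfl⟩
    have hxy : (x * y : G) ∈ Λ ^ 4 ∩ H :=
      ⟨by rw [show (4 : ℕ) = 2 + 2 from rfl, pow_add]; exact Set.mul_mem_mul hx hy,
        H.mul_mem x.2 y.2⟩
    obtain ⟨f, hf, z, ⟨hz, hzH⟩, hfz⟩ := hF.2 hxy
    have hfH : f ∈ H := by
      have h1 : f * z = x * y := hfz
      rw [eq_mul_inv_of_mul_eq h1]
      exact H.mul_mem (H.mul_mem x.2 y.2) (H.inv_mem hzH)
    exact ⟨⟨f, hfH⟩, by simpa [E] using hf, ⟨z, hzH⟩, hz, Subtype.ext hfz⟩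

variable [TopologicalSpace G] [IsTopologicalGroup G]

/-- A compact set is covered by finitely many right translates of `W`, and each contains at most one
point of `Λ`. -/
theorem IsUniformlyDiscrete.isLocallyFiniteSubset (hd : IsUniformlyDiscrete Λ) :
    IsLocallyFiniteSubset Λ := by
  obtain ⟨V, hV, hΛ⟩ := hd
  have hdiv : Filter.Tendsto (fun p : G × G => p.1 * p.2⁻¹) (𝓝 (1, 1)) (𝓝 1) := by
    have : Continuous (fun p : G × G => p.1 * p.2⁻¹) := by fun_prop
    simpa using this.tendsto (1, 1)
  rw [nhds_prod_eq] at hdiv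
  obtain ⟨W, hW, hWV⟩ := Filter.mem_prod_same_iff.1 (hdiv hV)
  intro K hK
  have hN : ∀ x ∈ K, {y : G | y * x⁻¹ ∈ W} ∈ 𝓝 x := by
    intro x _
    have : Continuous (fun y : G => y * x⁻¹) := by fun_prop
    exact this.continuousAt.preimage_mem_nhds (by simpa using hW)
  obtain ⟨T, -, hT⟩ := hK.elim_nhds_subcover _ hN
  refine (T.finite_toSet.biUnion (t := fun x => Λ ∩ {y : G | y * x⁻¹ ∈ W})
    fun x _ => Set.Subsingleton.finite ?_).subset ?_
  · rintro a ⟨haΛ, ha⟩ b ⟨hbΛ, hb⟩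
    have hab : a * b⁻¹ ∈ (Λ * Λ⁻¹) ∩ V := by
      refine ⟨Set.mul_mem_mul haΛ (Set.inv_mem_inv.2 hbΛ), ?_⟩
      have := hWV (Set.mk_mem_prod ha hb)
      simpa using this
    rw [hΛ] at hab
    exact mul_inv_eq_one.1 hab
  · rintro y ⟨hyΛ, hyK⟩
    obtain ⟨x, hx, hxy⟩ := mem_iUnion₂.1 (hT hyK)
    exact mem_biUnion hx ⟨hyΛ, hxy⟩

theorem IsApproxSubgroup.isLocallyFiniteSubset_pow (hΛ : IsApproxSubgroup Λ)
    (hd : IsUniformlyDiscrete Λ) {n : ℕ} (hn : n ≠ 0) : IsLocallyFiniteSubset (Λ ^ n) := by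
  obtain ⟨F, hF, h⟩ := hΛ.exists_finite_pow_subset hn
  exact (hd.isLocallyFiniteSubset.finite_mul hF).mono h

theorem IsApproxSubgroup.isLocallyFiniteSubset_image_pow (hΛ : IsApproxSubgroup Λ) (H : Subgroup G)
    [H.Normal] (hp : IsLocallyFiniteSubset ((QuotientGroup.mk : G → G ⧸ H) '' Λ)) {n : ℕ}
    (hn : n ≠ 0) : IsLocallyFiniteSubset ((QuotientGroup.mk : G → G ⧸ H) '' (Λ ^ n)) := by
  obtain ⟨F, hF, h⟩ := hΛ.exists_finite_pow_subset hn
  refine (hp.finite_mul (hF.image (QuotientGroup.mk' H))).mono ?_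
  have := image_mono (f := QuotientGroup.mk' H) h
  rwa [Set.image_mul] at this

variable [T2Space G] [LocallyCompactSpace G]

/-- The quotients of elements of `Λ²` lie in `Λ⁴`, which is locally finite, so `1` is isolated in
it. -/
theorem IsApproxSubgroup.isUniformlyDiscrete_comap_sq (hΛ : IsApproxSubgroup Λ)
    (hd : IsUniformlyDiscrete Λ) (H : Subgroup G) :
    IsUniformlyDiscrete ((Subtype.val : H → G) ⁻¹' (Λ ^ 2)) := by
  obtain ⟨U, hU, h1U, hΛU⟩ :=
    (hΛ.isLocallyFiniteSubset_pow hd (n := 4) (by norm_num)).exists_isOpen 1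
  refine ⟨(Subtype.val : H → G) ⁻¹' U,
    continuous_subtype_val.continuousAt.preimage_mem_nhds (hU.mem_nhds h1U), ?_⟩
  refine subset_antisymm ?_ ?_
  · rintro _ ⟨⟨x, hx, y, hy, rfl⟩, hxyU⟩
    refine Subtype.ext (hΛU ⟨?_, hxyU⟩)
    rw [show (4 : ℕ) = 2 + 2 from rfl, pow_add]
    exact Set.mul_mem_mul hx (by simpa using hΛ.sq_inv_mem hy)
  · rintro _ rfl
    have h1 : (1 : G) ∈ Λ ^ 2 := Set.one_mem_pow hΛ.one_mem
    exact ⟨⟨1, h1, 1, by simpa using h1, mul_one 1⟩, h1U⟩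

/-- A uniform approximate lattice meets a subgroup in a uniform approximate lattice when its image
in the coset space is locally finite. -/
theorem IsUniformApproxLattice.comap_sq (h : IsUniformApproxLattice Λ) (H : Subgroup G)
    (hH : IsClosed (H : Set G))
    (hp : IsLocallyFiniteSubset ((QuotientGroup.mk : G → G ⧸ H) '' Λ)) :
    IsUniformApproxLattice ((Subtype.val : H → G) ⁻¹' (Λ ^ 2)) := by
  have hΛ := h.isApproxSubgroup
  refine ⟨hΛ.comap_sq H, hΛ.isUniformlyDiscrete_comap_sq h.isUniformlyDiscrete H, ?_⟩
  obtain ⟨K, hK, hΛK⟩ := h.relativelyDense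
  have hfin := hp _ (hK.image (QuotientGroup.continuous_mk (N := H)))
  -- `E` is a finite set of representatives in `Λ` of the cosets that meet both `Λ` and `K`.
  obtain ⟨E, hEΛ, hE, hEim⟩ := Set.exists_subset_image_finite_and.1
    ⟨_, inter_subset_left, hfin, (rfl : (QuotientGroup.mk : G → G ⧸ H) '' Λ ∩
      QuotientGroup.mk '' K = _)⟩
  have hemb : IsClosedEmbedding (Subtype.val : H → G) := hH.isClosedEmbedding_subtypeVal
  refine ⟨⋃ f ∈ E, (Subtype.val : H → G) ⁻¹' (f⁻¹ • K),
    hE.isCompact_biUnion fun f _ => hemb.isCompact_preimage (hK.smul f⁻¹), ?_⟩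
  refine eq_univ_of_forall fun x => ?_
  obtain ⟨l, hl, k, hk, hlk⟩ : (x : G) ∈ Λ * K := hΛK ▸ mem_univ _
  have hlk : l * k = x := hlk
  -- From `x = l * k` follows `l⁻¹ = k * x⁻¹`, which lies in the coset of `k`.
  have hmem : (QuotientGroup.mk l⁻¹ : G ⧸ H) ∈ (QuotientGroup.mk : G → G ⧸ H) '' E := by
    rw [← hEim]
    refine ⟨⟨_, hΛ.inv_mem hl, rfl⟩, k, hk, ?_⟩
    rw [QuotientGroup.eq, inv_mul_eq_iff_eq_mul.2 (show l⁻¹ = k * (k⁻¹ * l⁻¹) by group)]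
    rw [← mul_inv_rev, hlk]
    exact H.inv_mem x.2
  obtain ⟨f, hf, hfl⟩ := hmem
  have hfl : f⁻¹ * l⁻¹ ∈ H := QuotientGroup.eq.1 hfl
  have hlf : l * f ∈ H := by simpa using H.inv_mem hfl
  refine ⟨⟨l * f, hlf⟩, ?_, ⟨f⁻¹ * l⁻¹ * x, H.mul_mem hfl x.2⟩, ?_, Subtype.ext ?_⟩
  · rw [mem_preimage, sq]
    exact Set.mul_mem_mul hl (hEΛ hf)
  · refine mem_biUnion hf ⟨k, hk, ?_⟩
    simp [← hlk, mul_assoc]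
  · simp [mul_assoc]

end ApproxSubgroup

/-! ### Invariant hulls and the slice by a normal subgroup -/

section Hull

variable {G : Type*} [Group G] [TopologicalSpace G] [IsTopologicalGroup G]

/-- The condition is unchanged by left translation. If it failed at `x`, `y`, it would fail for all
closed sets meeting small neighbourhoods of both points, hence for some translate of `F`. -/
theorem inv_mul_mem_of_mem_invariantHull {F P : ClosedSubset G} {S : Set G} (hS : IsClosed S)
    (hFS : ∀ x ∈ (F : Set G), ∀ y ∈ (F : Set G), x⁻¹ * y ∈ S) (hP : P ∈ invariantHull F)
    {x y : G} (hx : x ∈ (P : Set G)) (hy : y ∈ (P : Set G)) : x⁻¹ * y ∈ S := by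
  by_contra hxy
  have hcont : Continuous fun p : G × G => p.1⁻¹ * p.2 := by fun_prop
  obtain ⟨A, B, hA, hxA, hB, hyB, hAB⟩ := mem_nhds_prod_iff'.1
    (hcont.continuousAt.preimage_mem_nhds (x := (x, y)) (hS.isOpen_compl.mem_nhds hxy))
  obtain ⟨_, ⟨⟨a, ha, haA⟩, b, hb, hbB⟩, g, rfl⟩ := mem_closure_iff.1 hP _
    ((ClosedSubset.isOpen_setOf_inter_nonempty hA).inter
      (ClosedSubset.isOpen_setOf_inter_nonempty hB)) ⟨⟨x, hx, hxA⟩, y, hy, hyB⟩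
  obtain ⟨a, ha, rfl⟩ := ha
  obtain ⟨b, hb, rfl⟩ := hb
  refine hAB (mk_mem_prod haA hbB) ?_
  simpa [mul_assoc] using hFS a ha b hb

theorem smul_mem_invariantHull [LocallyCompactSpace G] {F P : ClosedSubset G}
    (hP : P ∈ invariantHull F) (g : G) : g • P ∈ invariantHull F := by
  refine map_mem_closure (continuous_const_smul g) hP ?_
  rintro _ ⟨k, rfl⟩
  exact ⟨g * k, mul_smul g k F⟩

omit [IsTopologicalGroup G] in
/-- Intersecting with `H` is continuous on the closed subsets of a set that coincides with a subset
of `H` near `H`. -/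
theorem ClosedSubset.continuousOn_inter (H : Subgroup G) {L O : Set G} (hO : IsOpen O)
    (hHO : (H : Set G) ⊆ O) (hLO : L ∩ O ⊆ H) :
    ContinuousOn (fun P : ClosedSubset G => P.inter H) {P | (P : Set G) ⊆ L} := by
  rw [continuousOn_iff_continuous_domRestrict]
  refine continuous_generateFrom_iff.2 ?_
  rintro _ (⟨_, ⟨V, hV, rfl⟩, rfl⟩ | ⟨K, hK, rfl⟩)
  · refine Eq.subst (motive := IsOpen) ?_
      ((ClosedSubset.isOpen_setOf_inter_nonempty (hV.inter hO)).preimage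
      (continuous_subtype_val (p := fun P : ClosedSubset G => (P : Set G) ⊆ L)))
    refine Set.ext fun ⟨P, hP⟩ => Iff.symm ?_
    constructor
    · rintro ⟨x, hx, hxV⟩
      exact ⟨x, hx, hxV, hHO x.2⟩
    · rintro ⟨x, hx, hxV, hxO⟩
      exact ⟨⟨x, hLO ⟨hP hx, hxO⟩⟩, hx, hxV⟩
  · refine Eq.subst (motive := IsOpen) ?_
      ((ClosedSubset.isOpen_setOf_inter_eq_empty
        (hK.image continuous_subtype_val)).preimage
      (continuous_subtype_val (p := fun P : ClosedSubset G => (P : Set G) ⊆ L)))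
    refine Set.ext fun ⟨P, hP⟩ => Iff.symm ?_
    have : (Subtype.val '' ((Subtype.val : H → G) ⁻¹' (P : Set G) ∩ K)) =
        (P : Set G) ∩ Subtype.val '' K := by
      rw [image_preimage_inter]
    change (Subtype.val : H → G) ⁻¹' (P : Set G) ∩ K = ∅ ↔ (P : Set G) ∩ Subtype.val '' K = ∅
    rw [← this, image_eq_empty]

theorem exists_mem_invariantHull_hasProperInvariantMeasure_inter [T2Space G] [LocallyCompactSpace G]
    [SecondCountableTopology G] {Λ : ClosedSubset G} (hΛ : IsApproxSubgroup (Λ : Set G))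
    (hd : IsUniformlyDiscrete (Λ : Set G)) (hν : HasProperInvariantMeasure Λ) (H : Subgroup G)
    [H.Normal] (hH : IsClosed (H : Set G))
    (hp : IsLocallyFiniteSubset ((QuotientGroup.mk : G → G ⧸ H) '' (Λ : Set G))) :
    ∃ P ∈ invariantHull Λ, 1 ∈ (P : Set G) ∧ (P : Set G) ⊆ (Λ : Set G) ^ 2 ∧
      HasProperInvariantMeasure (P.inter H) := by
  obtain ⟨ν, hν1, hνinv, hνhull, hνempty⟩ := hν
  have hH2 : SecondCountableTopology H := inferInstanceAs (SecondCountableTopology (H : Set G))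
  have hHlc : LocallyCompactSpace H := hH.isClosedEmbedding_subtypeVal.locallyCompactSpace
  have hνH : SMulInvariantMeasure H (ClosedSubset G) ν :=
    ⟨fun h s hs => hνinv.measure_preimage_smul (h : G) hs⟩
  obtain ⟨P, ⟨⟨κ, hκ1, hκinv, hκorb, hκU⟩, hPhull⟩, hPne⟩ :=
    (((ae_exists_smulInvariantMeasure_closure_orbit H ν).and
      (measure_eq_zero_iff_ae_notMem.1 hνhull)).and
      (measure_eq_zero_iff_ae_notMem.1 hνempty)).exists
  have hPhull : P ∈ invariantHull Λ := not_not.1 hPhull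
  obtain ⟨g, hg⟩ : (P : Set G).Nonempty := Set.nonempty_iff_ne_empty.2 hPne
  have hdiff : ∀ y ∈ (P : Set G), g⁻¹ * y ∈ (Λ : Set G) ^ 2 := fun y hy =>
    inv_mul_mem_of_mem_invariantHull (hΛ.isLocallyFiniteSubset_pow hd two_ne_zero).isClosed
      (fun a ha b hb => by rw [sq]; exact Set.mul_mem_mul (hΛ.inv_mem ha) hb) hPhull hg hy
  have hT3 : T3Space (G ⧸ H) := QuotientGroup.instT3Space (hN := hH) H
  have hLfin := hΛ.isLocallyFiniteSubset_image_pow H hp two_ne_zero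
  obtain ⟨W, hW, h1W, hLW⟩ := hLfin.exists_isOpen (QuotientGroup.mk 1)
  let L : Set G := (QuotientGroup.mk : G → G ⧸ H) ⁻¹' (QuotientGroup.mk '' ((Λ : Set G) ^ 2))
  let O : Set G := (QuotientGroup.mk : G → G ⧸ H) ⁻¹' W
  have hL : IsClosed L := hLfin.isClosed.preimage QuotientGroup.continuous_mk
  have hO : IsOpen O := hW.preimage QuotientGroup.continuous_mk
  have hHO : (H : Set G) ⊆ O := fun x hx => by
    have : (QuotientGroup.mk x : G ⧸ H) = QuotientGroup.mk 1 :=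
      QuotientGroup.eq.2 (by simpa using hx)
    rw [mem_preimage, this]
    exact h1W
  have hLO : L ∩ O ⊆ H := fun x hx => by
    have : (QuotientGroup.mk x : G ⧸ H) = QuotientGroup.mk 1 := hLW hx
    simpa using QuotientGroup.eq.1 this
  -- By normality, left translation by `h` does not change cosets. This keeps the whole `H`-orbit of
  -- `P` in `Z`, where `Φ` is continuous.
  have hconj : ∀ (h : H) (y : G),
      (QuotientGroup.mk (g⁻¹ * (h * y)) : G ⧸ H) = QuotientGroup.mk (g⁻¹ * y) := by
    intro h y
    refine (QuotientGroup.eq.2 ?_).symm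
    convert ‹H.Normal›.conj_mem h h.2 y⁻¹ using 1
    group
  let Φ : ClosedSubset G → ClosedSubset H := fun Q => (g⁻¹ • Q).inter H
  let Z : Set (ClosedSubset G) := {Q | ((g⁻¹ • Q : ClosedSubset G) : Set G) ⊆ L}
  have hZ : IsClosed Z :=
    (ClosedSubset.isClosed_setOf_subset hL).preimage (continuous_const_smul g⁻¹)
  have hΦ : ContinuousOn Φ Z :=
    (ClosedSubset.continuousOn_inter H hO hHO hLO).comp
      (continuous_const_smul g⁻¹).continuousOn fun Q hQ => hQ
  have horbZ : closure (MulAction.orbit H P) ⊆ Z := by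
    refine closure_minimal ?_ hZ
    rintro _ ⟨h, rfl⟩ _ ⟨_, ⟨y, hy, rfl⟩, rfl⟩
    change (QuotientGroup.mk (g⁻¹ * (h * y)) : G ⧸ H) ∈ QuotientGroup.mk '' ((Λ : Set G) ^ 2)
    rw [hconj]
    exact ⟨_, hdiff y hy, rfl⟩
  -- `Φ` is equivariant up to conjugation by `g`, an automorphism of `H`, which is enough for
  -- invariance and for mapping orbits onto orbits.
  have hΦsmul : ∀ (h : H) (Q : ClosedSubset G),
      Φ ((⟨g * h * g⁻¹, ‹H.Normal›.conj_mem h h.2 g⟩ : H) • Q)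
      = h • Φ Q := by
    intro h Q
    change (g⁻¹ • (g * h * g⁻¹) • Q).inter H = h • (g⁻¹ • Q).inter H
    rw [← ClosedSubset.smul_inter, smul_smul, smul_smul]
    congr 2
    group
  have hκorb' : ∀ᵐ Q ∂κ, Q ∈ closure (MulAction.orbit H P) := by
    filter_upwards [measure_eq_zero_iff_ae_notMem.1 hκorb] with Q hQ using not_not.1 hQ
  have hΦm : AEMeasurable Φ κ := by
    have := hΦ.aemeasurable (μ := κ) hZ.measurableSet
    rwa [Measure.restrict_eq_self_of_ae_mem (hκorb'.mono fun Q hQ => horbZ hQ)] at this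
  -- Source of properness: meeting the open set `g • O` is an `H`-stable open condition that `P`
  -- satisfies, so almost every `Q` satisfies it. For `Q` in `Z`, the point found then lies in `g •
  -- H`.
  have hκmeet : ∀ᵐ (Q : ClosedSubset G) ∂κ, ((Q : Set G) ∩ (g⁻¹ * ·) ⁻¹' O).Nonempty := by
    have := hκU {Q : ClosedSubset G | ((Q : Set G) ∩ (g⁻¹ * ·) ⁻¹' O).Nonempty}
      (ClosedSubset.isOpen_setOf_inter_nonempty (hO.preimage (continuous_const_mul g⁻¹)))
      ⟨g, hg, by simpa using hHO H.one_mem⟩ ?_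
    · filter_upwards [measure_eq_zero_iff_ae_notMem.1 this] with Q hQ using not_not.1 hQ
    · rintro h Q ⟨y, hy, hyO⟩
      refine ⟨h * y, Set.smul_mem_smul_set hy, ?_⟩
      change (QuotientGroup.mk (g⁻¹ * (h * y)) : G ⧸ H) ∈ W
      rwa [hconj]
  have hP1 : (g⁻¹ • P : ClosedSubset G) ∈ invariantHull Λ := smul_mem_invariantHull hPhull g⁻¹
  refine ⟨g⁻¹ • P, hP1, ⟨g, hg, inv_mul_cancel g⟩, ?_, κ.map Φ,
    Measure.isProbabilityMeasure_map hΦm, ⟨fun h s hs => ?_⟩, ?_, ?_⟩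
  · rintro _ ⟨y, hy, rfl⟩
    exact hdiff y hy
  · rw [Measure.map_apply_of_aemeasurable hΦm hs, Measure.map_apply_of_aemeasurable hΦm
      (measurable_const_smul h hs),
      ← measure_preimage_smul κ (⟨g * h * g⁻¹, ‹H.Normal›.conj_mem h h.2 g⟩ : H) (Φ ⁻¹' s)]
    congr 1
    ext Q
    simp only [mem_preimage, hΦsmul]
  · change κ.map Φ (closure (MulAction.orbit H (Φ P)))ᶜ = 0
    rw [Measure.map_apply_of_aemeasurable hΦm isClosed_closure.measurableSet.compl]
    refine measure_mono_null (t := (closure (MulAction.orbit H P))ᶜ) (fun Q hQ hQP => hQ ?_) hκorb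
    have := (hΦ.mono horbZ).image_closure ⟨Q, hQP, rfl⟩
    refine closure_mono ?_ this
    rintro _ ⟨_, ⟨h, rfl⟩, rfl⟩
    refine ⟨⟨g⁻¹ * h * g, ?_⟩, ?_⟩
    · simpa using ‹H.Normal›.conj_mem h h.2 g⁻¹
    · change _ = Φ (h • P)
      have := hΦsmul ⟨g⁻¹ * h * g, by simpa using ‹H.Normal›.conj_mem h h.2 g⁻¹⟩ P
      refine this.symm.trans ?_
      congr 2
      refine Subtype.ext ?_
      simp [mul_assoc]
  · rw [Measure.map_apply_of_aemeasurable hΦm ClosedSubset.measurableSet_setOf_eq_empty,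
      measure_eq_zero_iff_ae_notMem]
    filter_upwards [hκorb', hκmeet] with Q hQ ⟨y, hy, hyO⟩ hQe
    have hyL : g⁻¹ * y ∈ L := horbZ hQ ⟨y, hy, rfl⟩
    have : (⟨g⁻¹ * y, hLO ⟨hyL, hyO⟩⟩ : H) ∈ ((Φ Q : ClosedSubset H) : Set H) := ⟨y, hy, rfl⟩
    rw [show ((Φ Q : ClosedSubset H) : Set H) = ∅ from hQe] at this
    exact this

end Hull

/-! ### Positive functionals and test functions -/

section PositiveFunctional

/-- Positivity applied to `e` and `-e` makes `J` vanish on the kernel of `T`, so `J` descends to the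
range of `T`. The constant function `T e₁` is an order unit there, and M. Riesz's extension theorem
applies. -/
theorem exists_positive_extension {Y E : Type*} [TopologicalSpace Y] [AddCommGroup E]
    [Module ℝ E] (T : E →ₗ[ℝ] (Y →ᵇ ℝ))
    (J : E →ₗ[ℝ] ℝ) (hJ : ∀ e, (∀ x, 0 ≤ T e x) → 0 ≤ J e) (e₁ : E) (he₁ : ∀ x, T e₁ x = 1) :
    ∃ L : (Y →ᵇ ℝ) →ₗ[ℝ] ℝ, (∀ u : Y →ᵇ ℝ, (∀ x, 0 ≤ u x) → 0 ≤ L u) ∧ ∀ e, L (T e) = J e := by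
  have hker : LinearMap.ker T ≤ LinearMap.ker J := by
    intro e he
    have he : T e = 0 := he
    refine le_antisymm ?_ (hJ e fun x => by simp [he])
    have := hJ (-e) fun x => by simp [he]
    simpa using this
  let f : (Y →ᵇ ℝ) →ₗ.[ℝ] ℝ :=
    ⟨LinearMap.range T, (LinearMap.ker T).liftQ J hker ∘ₗ T.quotKerEquivRange.symm.toLinearMap⟩
  have hf : ∀ e, f ⟨T e, LinearMap.mem_range_self T e⟩ = J e := by
    intro e
    change (LinearMap.ker T).liftQ J hker (T.quotKerEquivRange.symm _) = J e
    rw [LinearMap.quotKerEquivRange_symm_apply_image]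
    rfl
  let s : PointedCone ℝ (Y →ᵇ ℝ) :=
    { carrier := {u | ∀ x, 0 ≤ u x}
      add_mem' := fun hu hv x => add_nonneg (hu x) (hv x)
      zero_mem' := fun _ => le_rfl
      smul_mem' := fun c u hu x => mul_nonneg c.2 (hu x) }
  have hnonneg : ∀ u : f.domain, (u : Y →ᵇ ℝ) ∈ s → 0 ≤ f u := by
    rintro ⟨_, e, rfl⟩ he
    rw [hf]
    exact hJ e he
  have hdense : ∀ u : Y →ᵇ ℝ, ∃ v : f.domain, (v : Y →ᵇ ℝ) + u ∈ s := by
    intro u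
    refine ⟨⟨T (‖u‖ • e₁), LinearMap.mem_range_self T _⟩, fun x => ?_⟩
    have := (abs_le.1 (u.norm_coe_le_norm x)).1
    simp only [map_smul, BoundedContinuousFunction.coe_add, BoundedContinuousFunction.coe_smul,
      Pi.add_apply, he₁, smul_eq_mul, mul_one]
    linarith
  obtain ⟨L, hLf, hLs⟩ := riesz_extension s f hnonneg hdense
  exact ⟨L, hLs, fun e => (hLf ⟨T e, LinearMap.mem_range_self T e⟩).trans (hf e)⟩

variable {X : Type*} [TopologicalSpace X] [CompactSpace X]

theorem abs_le_norm_of_nonneg_of_map_one (ℓ : C(X, ℝ) →ₗ[ℝ] ℝ)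
    (hpos : ∀ f : C(X, ℝ), (∀ x, 0 ≤ f x) → 0 ≤ ℓ f)
    (hone : ℓ 1 = 1) (f : C(X, ℝ)) : |ℓ f| ≤ ‖f‖ := by
  have h1 := hpos (‖f‖ • (1 : C(X, ℝ)) - f) fun x => by
    have := (abs_le.1 (f.norm_coe_le_norm x)).2
    simpa using this
  have h2 := hpos (‖f‖ • (1 : C(X, ℝ)) + f) fun x => by
    have := (abs_le.1 (f.norm_coe_le_norm x)).1
    simp only [ContinuousMap.add_apply, ContinuousMap.smul_apply, ContinuousMap.one_apply,
      smul_eq_mul, mul_one]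
    linarith
  simp only [map_sub, map_add, map_smul, hone, smul_eq_mul, mul_one] at h1 h2
  exact abs_le.2 ⟨by linarith, by linarith⟩

theorem exists_isProbabilityMeasure_integral_eq [T2Space X] [MeasurableSpace X] [BorelSpace X]
    (ℓ : C(X, ℝ) →ₗ[ℝ] ℝ) (hpos : ∀ f : C(X, ℝ), (∀ x, 0 ≤ f x) → 0 ≤ ℓ f) (hone : ℓ 1 = 1) :
    ∃ μ : Measure X, IsProbabilityMeasure μ ∧ ∀ f : C(X, ℝ), ∫ x, f x ∂μ = ℓ f := by
  let T : CompactlySupportedContinuousMap X ℝ →ₗ[ℝ] ℝ :=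
    { toFun := fun f => ℓ f.toContinuousMap
      map_add' := fun f g => ℓ.map_add f.toContinuousMap g.toContinuousMap
      map_smul' := fun c f => ℓ.map_smul c f.toContinuousMap }
  let T' : CompactlySupportedContinuousMap X ℝ →ₚ[ℝ] ℝ :=
    PositiveLinearMap.mk₀ T fun f hf => hpos _ fun x => hf x
  have hint : ∀ f : C(X, ℝ), ∫ x, f x ∂(RealRMK.rieszMeasure T') = ℓ f := fun f =>
    RealRMK.integral_rieszMeasure T' (CompactlySupportedContinuousMap.continuousMapEquiv f)
  refine ⟨RealRMK.rieszMeasure T', ⟨?_⟩, hint⟩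
  have h1 := hint 1
  rw [hone] at h1
  simpa [measureReal_def, ENNReal.toReal_eq_one_iff] using h1

end PositiveFunctional

namespace ClosedSubset

/-- A monotone continuous function on closed subsets that vanishes at `∅` and is at least `1` at the
closed subsets that meet a given compact subset. -/
theorem exists_monotone_continuousMap {X : Type*} [TopologicalSpace X] [T2Space X]
    [LocallyCompactSpace X] {K : Set X} (hK : IsCompact K) :
    ∃ φ : C(ClosedSubset X, ℝ), (∀ F F' : ClosedSubset X, (F : Set X) ⊆ F' → φ F ≤ φ F') ∧
      (∀ F : ClosedSubset X, (F : Set X) = ∅ → φ F = 0) ∧ (∀ F, 0 ≤ φ F) ∧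
      ∀ F : ClosedSubset X, ((F : Set X) ∩ K).Nonempty → 1 ≤ φ F := by
  obtain ⟨ψ, hψK, -, hψc, hψ⟩ :=
    exists_continuous_one_zero_of_isCompact hK isClosed_empty (disjoint_empty K)
  -- The supremum of the bump function `ψ` over `F`, with `0` inserted to cover `F = ∅`. Compactness
  -- of the support makes it attained, so `{a < φ}` is a hitting set for `0 ≤ a` and `{φ < a}` a
  -- missing set for `0 < a`.
  let φ : ClosedSubset X → ℝ := fun F => sSup (insert 0 (ψ '' ((F : Set X) ∩ tsupport ψ)))
  have hgr : ∀ F : ClosedSubset X, IsGreatest (insert 0 (ψ '' ((F : Set X) ∩ tsupport ψ))) (φ F) :=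
    fun F => ((((hψc.isCompact.inter_left F.isClosed).image ψ.continuous).insert 0)).isGreatest_sSup
      (insert_nonempty _ _)
  have h0 : ∀ F, 0 ≤ φ F := fun F => (hgr F).2 (mem_insert _ _)
  have hle : ∀ (F : ClosedSubset X) (x : X), x ∈ (F : Set X) → ψ x ≤ φ F := by
    intro F x hx
    by_cases hxs : x ∈ tsupport ψ
    · exact (hgr F).2 (mem_insert_of_mem _ ⟨x, ⟨hx, hxs⟩, rfl⟩)
    · rw [image_eq_zero_of_notMem_tsupport hxs]
      exact h0 F
  have hcases : ∀ F, φ F = 0 ∨ ∃ x ∈ (F : Set X), x ∈ tsupport ψ ∧ ψ x = φ F := by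
    intro F
    rcases (hgr F).1 with h | ⟨x, ⟨hx, hxs⟩, h⟩
    exacts [Or.inl h, Or.inr ⟨x, hx, hxs, h⟩]
  have hcont : Continuous φ := by
    refine OrderTopology.continuous_iff.2 fun a => ⟨?_, ?_⟩
    · rcases lt_or_ge a 0 with ha | ha
      · convert isOpen_univ
        exact eq_univ_of_forall fun F => ha.trans_le (h0 F)
      · convert isOpen_setOf_inter_nonempty (isOpen_lt continuous_const ψ.continuous (f := fun _ => a))
          using 1
        refine Set.ext fun F => ⟨fun (hF : a < φ F) => ?_, ?_⟩
        · rcases hcases F with h | ⟨x, hx, -, h⟩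
          · exact absurd (h ▸ hF) (not_lt.2 ha)
          · exact ⟨x, hx, show a < ψ x from h ▸ hF⟩
        · rintro ⟨x, hx, hax⟩
          exact lt_of_lt_of_le hax (hle F x hx)
    · rcases le_or_gt a 0 with ha | ha
      · convert isOpen_empty
        exact eq_empty_of_forall_notMem fun F hF => not_lt.2 (h0 F) (lt_of_lt_of_le hF ha)
      · convert isOpen_setOf_inter_eq_empty (hψc.isCompact.inter_right
          (isClosed_le continuous_const ψ.continuous (f := fun _ => a))) using 1
        refine Set.ext fun F => ⟨fun (hF : φ F < a) => ?_, fun hF => ?_⟩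
        · refine eq_empty_of_forall_notMem ?_
          rintro x ⟨hx, -, hax⟩
          exact absurd (hle F x hx) (not_le.2 (hF.trans_le hax))
        · rcases hcases F with h | ⟨x, hx, hxs, h⟩
          · exact show φ F < a from h ▸ ha
          · by_contra hFa
            have : x ∈ (F : Set X) ∩ (tsupport ψ ∩ {y | a ≤ ψ y}) :=
              ⟨hx, hxs, show a ≤ ψ x from h ▸ not_lt.1 hFa⟩
            rw [show (F : Set X) ∩ (tsupport ψ ∩ {y | a ≤ ψ y}) = ∅ from hF] at this
            exact this
  refine ⟨⟨φ, hcont⟩, fun F F' hFF' => ?_, fun F hF => ?_, h0, ?_⟩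
  · rcases hcases F with h | ⟨x, hx, -, h⟩
    · exact h.trans_le (h0 F')
    · exact h.symm.trans_le (hle F' x (hFF' hx))
  · rcases hcases F with h | ⟨x, hx, -⟩
    · exact h
    · rw [hF] at hx
      exact absurd hx (notMem_empty x)
  · rintro F ⟨x, hx, hxK⟩
    exact (hψK hxK).symm.trans_le (hle F x hx)

end ClosedSubset

/-! ### Amenable groups and transfer of proper measures -/

section Amenable

variable {G : Type*} [Group G] [TopologicalSpace G] [IsTopologicalGroup G]

/-- The group fixes `∅`, so conditioning on the nonempty closed sets keeps invariance. -/
theorem HasProperInvariantMeasure.of_ne_one [LocallyCompactSpace G] {F : ClosedSubset G}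
    (μ : Measure (ClosedSubset G)) [IsProbabilityMeasure μ]
    [SMulInvariantMeasure G (ClosedSubset G) μ] (hF : μ (invariantHull F)ᶜ = 0)
    (h : μ {P : ClosedSubset G | (P : Set G) = ∅}ᶜ ≠ 0) : HasProperInvariantMeasure F := by
  have hm := (ClosedSubset.measurableSet_setOf_eq_empty (X := G)).compl
  refine ⟨ProbabilityTheory.cond μ {P : ClosedSubset G | (P : Set G) = ∅}ᶜ,
    ProbabilityTheory.cond_isProbabilityMeasure h, ⟨fun g s hs => ?_⟩, ?_, ?_⟩
  · rw [ProbabilityTheory.cond_apply hm, ProbabilityTheory.cond_apply hm,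
      ← measure_preimage_smul μ g ({P : ClosedSubset G | (P : Set G) = ∅}ᶜ ∩ s)]
    congr 2
    ext P
    simp [ClosedSubset.coe_smul]
  · rw [ProbabilityTheory.cond_apply hm, measure_mono_null inter_subset_right hF, mul_zero]
  · rw [ProbabilityTheory.cond_apply hm, compl_inter_self, measure_empty, mul_zero]

/-- The functions `g ↦ f (g • x)`, for `f` a continuous function on a compact space. -/
def orbitPullback {X : Type*} [TopologicalSpace X] [CompactSpace X] [MulAction G X]
    [ContinuousSMul G X] (x : X) : C(X, ℝ) →ₗ[ℝ] (G →ᵇ ℝ) where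
  toFun f := (BoundedContinuousFunction.mkOfCompact f).compContinuous
    ⟨fun g => g • x, continuous_id.smul continuous_const⟩
  map_add' _ _ := rfl
  map_smul' _ _ := rfl

/-- Averaging a positive functional over an amenable group. -/
theorem exists_invariant_positive_functional {X : Type*} [TopologicalSpace X] [CompactSpace X]
    [MulAction G X] [ContinuousSMul G X] (hG : IsAmenableGroup G) (ℓ : C(X, ℝ) →ₗ[ℝ] ℝ)
    (hpos : ∀ f : C(X, ℝ), (∀ x, 0 ≤ f x) → 0 ≤ ℓ f) (hone : ℓ 1 = 1) :
    ∃ L : C(X, ℝ) →ₗ[ℝ] ℝ, (∀ f : C(X, ℝ), (∀ x, 0 ≤ f x) → 0 ≤ L f) ∧ L 1 = 1 ∧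
      (∀ (g : G) (f : C(X, ℝ)), L (f.comp ⟨(g • ·), continuous_const_smul g⟩) = L f) ∧
      ∀ (f : C(X, ℝ)) (c : ℝ), (∀ g : G, c ≤ ℓ (f.comp ⟨(g • ·), continuous_const_smul g⟩)) →
        c ≤ L f := by
  obtain ⟨m, hmpos, hmone, hminv⟩ := hG
  have hbound := abs_le_norm_of_nonneg_of_map_one ℓ hpos hone
  have hℓcont : Continuous ℓ :=
    (LinearMap.mkContinuous ℓ 1 fun f => by simpa using hbound f).continuous
  -- Currying the action gives continuity of `g ↦ f ∘ g` in the uniform norm, for which `ℓ` is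
  -- continuous.
  have hcont : ∀ f : C(X, ℝ),
      Continuous fun g : G => ℓ (f.comp ⟨(g • ·), continuous_const_smul g⟩) := fun f =>
    hℓcont.comp (ContinuousMap.curry (⟨fun p : G × X => f (p.1 • p.2),
      f.continuous.comp continuous_smul⟩ : C(G × X, ℝ))).continuous
  let A : C(X, ℝ) →ₗ[ℝ] (G →ᵇ ℝ) :=
    { toFun := fun f => BoundedContinuousFunction.ofNormedAddCommGroup
        (fun g : G => ℓ (f.comp ⟨(g • ·), continuous_const_smul g⟩)) (hcont f) ‖f‖ fun g =>
          (hbound _).trans ((ContinuousMap.norm_le _ (norm_nonneg f)).2 fun x =>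
            f.norm_coe_le_norm _)
      map_add' := fun f₁ f₂ => by
        ext g
        exact ℓ.map_add (f₁.comp ⟨(g • ·), continuous_const_smul g⟩)
          (f₂.comp ⟨(g • ·), continuous_const_smul g⟩)
      map_smul' := fun c f => by
        ext g
        exact ℓ.map_smul c (f.comp ⟨(g • ·), continuous_const_smul g⟩) }
  have hA : ∀ f g, A f g = ℓ (f.comp ⟨(g • ·), continuous_const_smul g⟩) := fun _ _ => rfl
  have hle : ∀ (f : C(X, ℝ)) (c : ℝ),
      (∀ g : G, c ≤ ℓ (f.comp ⟨(g • ·), continuous_const_smul g⟩)) → c ≤ m (A f) := by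
    intro f c hc
    have := hmpos (A f - c • BoundedContinuousFunction.const G 1) fun g => by
      simpa [hA] using hc g
    rw [map_sub, map_smul, hmone] at this
    simpa using this
  refine ⟨m ∘ₗ A, fun f hf => hle f 0 fun g => hpos _ fun x => hf _, ?_, fun g f => ?_, hle⟩
  · have : A 1 = BoundedContinuousFunction.const G 1 := by
      ext g
      exact hone
    rw [LinearMap.comp_apply, this, hmone]
  -- The function attached to `f ∘ g` is `h ↦ A f (g * h)`, the left translate of `A f` by `g⁻¹`.
  · rw [LinearMap.comp_apply, LinearMap.comp_apply, ← hminv g⁻¹ (A f)]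
    congr 1
    ext h
    change A _ h = A f (g⁻¹⁻¹ * h)
    rw [hA, hA]
    congr 1
    ext x
    simp [mul_smul]

/-- For an amenable group, properness of an invariant measure on a hull passes to larger closed
sets. -/
theorem HasProperInvariantMeasure.mono [T2Space G] [LocallyCompactSpace G]
    [SecondCountableTopology G] (hG : IsAmenableGroup G) {F₁ F : ClosedSubset G}
    (hF : (F₁ : Set G) ⊆ F) (h : HasProperInvariantMeasure F₁) : HasProperInvariantMeasure F := by
  obtain ⟨κ, hκ1, hκinv, hκhull, hκempty⟩ := h
  have hκint : ∀ f : C(ClosedSubset G, ℝ), Integrable f κ := fun f =>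
    (BoundedContinuousFunction.mkOfCompact f).integrable κ
  -- A function that is nonnegative on the orbit of `F₁` is nonnegative on its closure, so the
  -- `κ`-integral is positive as a functional of the orbit function.
  obtain ⟨L₀, hL₀pos, hL₀⟩ := exists_positive_extension (orbitPullback (G := G) F₁)
    { toFun := fun f : C(ClosedSubset G, ℝ) => ∫ P, f P ∂κ
      map_add' := fun f g => integral_add (hκint f) (hκint g)
      map_smul' := fun c f => integral_const_mul c f }
    (fun f hf => integral_nonneg_of_ae <| by
      have hcl : invariantHull F₁ ⊆ {P | 0 ≤ f P} := by
        refine closure_minimal ?_ (isClosed_le continuous_const f.continuous)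
        rintro _ ⟨g, rfl⟩
        exact hf g
      filter_upwards [measure_eq_zero_iff_ae_notMem.1 hκhull] with P hP
      exact hcl (not_not.1 hP)) 1 (fun _ => rfl)
  have hL₀ : ∀ f : C(ClosedSubset G, ℝ), L₀ (orbitPullback F₁ f) = ∫ P, f P ∂κ := hL₀
  have hL₀mono : ∀ u v : G →ᵇ ℝ, (∀ x, u x ≤ v x) → L₀ u ≤ L₀ v := fun u v huv => by
    have := hL₀pos (v - u) fun x => sub_nonneg.2 (huv x)
    rw [map_sub] at this
    linarith
  -- The extension moves from `F₁` to `F`: it is now evaluated on the orbit functions of `F`.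
  let ℓ : C(ClosedSubset G, ℝ) →ₗ[ℝ] ℝ := L₀ ∘ₗ orbitPullback F
  have hℓ1 : ℓ 1 = 1 := by
    change L₀ (orbitPullback F₁ 1) = 1
    rw [hL₀]
    simp
  obtain ⟨L, hLpos, hL1, hLinv, hLle⟩ := exists_invariant_positive_functional hG ℓ
    (fun f hf => hL₀pos _ fun g => hf _) hℓ1
  obtain ⟨μ, hμ1, hμ⟩ := exists_isProbabilityMeasure_integral_eq L hLpos hL1
  have hmeas : ∀ g : G, Measurable (g • · : ClosedSubset G → ClosedSubset G) := fun g =>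
    (continuous_const_smul g).measurable
  have hμinv : SMulInvariantMeasure G (ClosedSubset G) μ := by
    refine ⟨fun g s hs => ?_⟩
    have : μ.map (g • ·) = μ := by
      have := Measure.isProbabilityMeasure_map (μ := μ) (hmeas g).aemeasurable
      refine ext_of_forall_integral_eq_of_IsFiniteMeasure fun f => ?_
      rw [integral_map (hmeas g).aemeasurable f.continuous.aestronglyMeasurable]
      exact (hμ (f.toContinuousMap.comp ⟨(g • ·), continuous_const_smul g⟩)).trans
        ((hLinv g f.toContinuousMap).trans (hμ f.toContinuousMap).symm)
    rw [← Measure.map_apply (hmeas g) hs, this]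
  refine HasProperInvariantMeasure.of_ne_one μ ?_ fun hμe => ?_
  -- The distance to the hull of `F` vanishes on the orbit of `F`, so its `μ`-integral is zero and
  -- `μ` is carried by the hull.
  · let := TopologicalSpace.metrizableSpaceMetric (ClosedSubset G)
    let d : C(ClosedSubset G, ℝ) :=
      ⟨fun P => Metric.infDist P (invariantHull F), Metric.continuous_infDist_pt _⟩
    have hd0 : ∀ P, 0 ≤ d P := fun P => Metric.infDist_nonneg
    have hint : ∫ P, d P ∂μ = 0 := by
      refine le_antisymm ?_ (integral_nonneg hd0)
      have := hLle (-d) 0 fun g => by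
        refine hL₀pos _ fun k => ?_
        change 0 ≤ - Metric.infDist (g • k • F) (invariantHull F)
        rw [Metric.infDist_zero_of_mem, neg_zero]
        exact subset_closure ⟨g * k, mul_smul g k F⟩
      rw [map_neg, ← hμ] at this
      linarith
    have hae := (integral_eq_zero_iff_of_nonneg hd0
      ((BoundedContinuousFunction.mkOfCompact d).integrable μ)).1 hint
    rw [measure_eq_zero_iff_ae_notMem]
    filter_upwards [hae] with P hP
    refine not_not.2 ?_
    have hne : (invariantHull F).Nonempty := ⟨F, subset_closure (MulAction.mem_orbit_self F)⟩
    exact (isClosed_closure.mem_iff_infDist_zero hne).2 hP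
  · obtain ⟨n, hn⟩ : ∃ n,
        κ {P : ClosedSubset G | ((P : Set G) ∩ compactCovering G n).Nonempty} ≠ 0 := by
      by_contra! hall
      have hzero := measure_iUnion_null hall
      have : κ univ = 0 := by
        refine measure_mono_null (fun P _ => ?_) (measure_union_null hκempty hzero)
        by_cases hP : (P : Set G) = ∅
        · exact Or.inl hP
        · obtain ⟨x, hx⟩ := Set.nonempty_iff_ne_empty.2 hP
          obtain ⟨n, hn⟩ := mem_iUnion.1 ((iUnion_compactCovering G).symm ▸ mem_univ x)
          exact Or.inr (mem_iUnion.2 ⟨n, x, hx, hn⟩)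
      simp at this
    obtain ⟨φ, hφmono, hφempty, hφ0, hφ1⟩ :=
      ClosedSubset.exists_monotone_continuousMap (isCompact_compactCovering G n)
    have hφκ : 0 < ∫ P, φ P ∂κ := by
      rw [integral_pos_iff_support_of_nonneg hφ0 (hκint φ)]
      refine (pos_iff_ne_zero.2 hn).trans_le (measure_mono fun P hP => ?_)
      exact (zero_lt_one.trans_le (hφ1 P hP)).ne'
    -- Monotonicity gives `φ (g • k • F₁) ≤ φ (g • k • F)` for all `g` and `k`. Applying `L₀` in `k`
    -- and using invariance of `κ` bounds `ℓ (φ ∘ g)` below by `∫ φ ∂κ` for each `g`, and averaging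
    -- keeps the bound.
    have hle : ∫ P, φ P ∂κ ≤ L φ := by
      refine hLle φ _ fun g => ?_
      have hinv : ∫ P, φ P ∂κ = ∫ P, φ (g • P) ∂κ :=
        ((measurePreserving_smul g κ).integral_comp'
          (f := (Homeomorph.smul g).toMeasurableEquiv) φ).symm
      refine hinv.trans_le ((hL₀ (φ.comp ⟨(g • ·), continuous_const_smul g⟩)).symm.trans_le ?_)
      refine hL₀mono _ _ fun k => ?_
      exact hφmono _ _ (Set.smul_set_mono (Set.smul_set_mono hF))
    have hzero : ∫ P, φ P ∂μ = 0 := by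
      refine integral_eq_zero_of_ae ?_
      filter_upwards [measure_eq_zero_iff_ae_notMem.1 hμe] with P hP
      exact hφempty P (not_not.1 hP)
    rw [← hμ, hzero] at hle
    linarith

end Amenable

theorem mainTheorem11 {G : Type*} [Group G] [TopologicalSpace G] [IsTopologicalGroup G]
    [T2Space G] [LocallyCompactSpace G]
    (Λ : Set G) (hΛ : IsApproxSubgroup Λ) (hd : IsUniformlyDiscrete Λ)
    (H : Subgroup G) (hH : IsClosed (H : Set G))
    (hp : IsLocallyFiniteSubset ((QuotientGroup.mk : G → G ⧸ H) '' Λ)) :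
    (IsUniformApproxLattice Λ →
      IsUniformApproxLattice ((Subtype.val : H → G) ⁻¹' (Λ ^ 2))) ∧
    (SecondCountableTopology G → IsStrongApproxLattice Λ → H.Normal →
      ∃ P ∈ invariantHull (⟨Λ, hd.isClosed⟩ : ClosedSubset G),
        HasProperInvariantMeasure (P.inter H)) ∧
    (SecondCountableTopology G → IsStrongApproxLattice Λ → H.Normal → IsAmenableGroup H →
      IsStrongApproxLattice ((Subtype.val : H → G) ⁻¹' (Λ ^ 2))) := by
  refine ⟨fun h => h.comap_sq H hH hp, fun hG2 h hN => ?_, fun hG2 h hN hA => ?_⟩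
  · obtain ⟨P, hP, -, -, hPm⟩ := exists_mem_invariantHull_hasProperInvariantMeasure_inter
      (Λ := ⟨Λ, hd.isClosed⟩) hΛ hd h.hasProperInvariantMeasure H hH hp
    exact ⟨P, hP, hPm⟩
  · obtain ⟨P, -, -, hPΛ, hPm⟩ := exists_mem_invariantHull_hasProperInvariantMeasure_inter
      (Λ := ⟨Λ, hd.isClosed⟩) hΛ hd h.hasProperInvariantMeasure H hH hp
    have hH2 : SecondCountableTopology H := inferInstanceAs (SecondCountableTopology (H : Set G))
    have hHlc : LocallyCompactSpace H := hH.isClosedEmbedding_subtypeVal.locallyCompactSpace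
    exact ⟨hΛ.comap_sq H, hΛ.isUniformlyDiscrete_comap_sq hd H,
      hPm.mono hA fun x hx => hPΛ hx⟩
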